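/- Let $A\in\mathbb{R}^{n\times n}$ and consider the discrete-time linear system $x_{k+1}=Ax_k$, $k\in\mathbb{N}$, with $x_k\in\mathbb{R}^n$. Call the system marginally stable if for every initial state $x_0\in\mathbb{R}^n$ there exists $c\geqslant 0$ such that the solution satisfies $\|x_k\|\leqslant c\|x_0\|$ for all $k\in\mathbb{N}$, where $\|\cdot\|$ is the Euclidean norm. The following statements are equivalent: (i) The system $x_{k+1}=Ax_k$ is marginally stable. (ii) There exist a symmetric positive-definite matrix $P\in\mathbb{R}^{n\times n}$ and a matrix $X\in\mathbb{R}^{n\times n}$ such that $$\begin{bmatrix} P & A^\top X^\top\\ XA & X+X^\top-P\end{bmatrix}\succcurlyeq 0.\qquad (1)$$ (iii) There exist a symmetric positive-definite matrix $S\in\mathbb{R}^{n\times n}$ and a matrix $X\in\mathbb{R}^{n\times n}$ such that $$\begin{bmatrix} S & AX\\ X^\top A^\top & X+X^\top-S\end{bmatrix}\succcurlyeq 0.\qquad (2)$$ Here $\succcurlyeq 0$ means symmetric positive semi-definite. Moreover, any matrix $X$ that satisfies (1) for some symmetric positive-definite $P$, or (2) for some symmetric positive-definite $S$, is non-singular.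 -/

import Mathlib

open scoped Matrix

/-- `x` is a solution of the discrete-time linear system `x_{k+1} = A x_k` on `ℝⁿ` with the
Euclidean norm. -/
def IsSolution {n : ℕ} (A : Matrix (Fin n) (Fin n) ℝ) (x : ℕ → EuclideanSpace ℝ (Fin n)) : Prop :=
  ∀ k : ℕ, x (k + 1) = WithLp.toLp 2 (A *ᵥ (x k).ofLp)

/-- The system `x_{k+1} = A x_k` is marginally stable: for every initial state the solution is
uniformly bounded in time, in the sense that there is `c ≥ 0` with `‖x_k‖ ≤ c ‖x_0‖` for all `k`.
By `marginallyStable_iff_uniform` below it makes no difference whether `c` may depend on the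
initial state. -/
def MarginallyStable {n : ℕ} (A : Matrix (Fin n) (Fin n) ℝ) : Prop :=
  ∀ x : ℕ → EuclideanSpace ℝ (Fin n), IsSolution A x →
    ∃ c : ℝ, 0 ≤ c ∧ ∀ k : ℕ, ‖x k‖ ≤ c * ‖x 0‖

theorem isSolution_iff {n : ℕ} (A : Matrix (Fin n) (Fin n) ℝ)
    (x : ℕ → EuclideanSpace ℝ (Fin n)) :
    IsSolution A x ↔ ∀ k : ℕ, x k = Matrix.toEuclideanCLM (𝕜 := ℝ) (A ^ k) (x 0) := by
  constructor
  · intro h k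
    induction k with
    | zero => simp
    | succ k ih =>
      rw [h k, ih, pow_succ', map_mul]
      rfl
  · intro h k
    rw [h (k + 1), h k, pow_succ', map_mul]
    rfl

/-- The constant in the definition of marginal stability can be chosen independently of the
initial state. -/
theorem marginallyStable_iff_uniform {n : ℕ} (A : Matrix (Fin n) (Fin n) ℝ) :
    MarginallyStable A ↔ ∃ c : ℝ, 0 ≤ c ∧
      ∀ x : ℕ → EuclideanSpace ℝ (Fin n), IsSolution A x → ∀ k : ℕ, ‖x k‖ ≤ c * ‖x 0‖ := by
  constructor
  · intro h
    obtain ⟨C, hC⟩ := banach_steinhaus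
      (g := fun k : ℕ => Matrix.toEuclideanCLM (n := Fin n) (𝕜 := ℝ) (A ^ k)) (by
        intro v
        obtain ⟨c, -, hc⟩ := h (fun k => Matrix.toEuclideanCLM (𝕜 := ℝ) (A ^ k) v)
          ((isSolution_iff A _).2 (by intro k; simp))
        exact ⟨_, hc⟩)
    refine ⟨C, (norm_nonneg _).trans (hC 0), fun x hx k => ?_⟩
    rw [(isSolution_iff A x).1 hx k]
    exact ContinuousLinearMap.le_of_opNorm_le _ (hC k) _
  · rintro ⟨c, hc, h⟩ x hx
    exact ⟨c, hc, h x hx⟩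

/-- The matrix inequality `[[P, AᵀXᵀ], [⋆, X + Xᵀ - P]] ≽ 0`, where `⋆` completes the symmetric
block matrix. -/
def ObserverLMI {n : ℕ} (A P X : Matrix (Fin n) (Fin n) ℝ) : Prop :=
  (Matrix.fromBlocks P (Aᵀ * Xᵀ) (Aᵀ * Xᵀ)ᵀ (X + Xᵀ - P)).PosSemidef

/-- The matrix inequality `[[S, AX], [⋆, X + Xᵀ - S]] ≽ 0`, where `⋆` completes the symmetric
block matrix. -/
def ControllerLMI {n : ℕ} (A S X : Matrix (Fin n) (Fin n) ℝ) : Prop :=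
  (Matrix.fromBlocks S (A * X) (A * X)ᵀ (X + Xᵀ - S)).PosSemidef

/-! Both inequalities encode a weak Lyapunov inequality `AᵀPA ≤ P` with `P` positive definite.
Testing (1) on `(x, -Ax)` cancels `X` and gives it; conversely `X = P` works by completing the
square. (2) is (1) for `Aᵀ`, `Xᵀ`, and transposition preserves marginal stability. The hard
direction, `exists_quadratic_lyapunov`, avoids the Jordan form. For power-bounded `T`, an idempotent
limit point `E` of the powers commutes with `T` and splits the space. On the range of `E` orbits
stay away from zero, so a limit of Cesàro means of `(T^k)* T^k` is an invariant form that is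
positive there. On the kernel some power of `T` is a strict contraction, and a finite sum of such
terms is a Lyapunov form. -/

open Filter Topology

/-! ### Idempotent limits of powers -/

section Idempotent

variable {R : Type*} [NormedRing R] [ProperSpace R]

/-- A power-bounded element of a proper normed ring has an idempotent among the limit points of
its positive powers. -/
theorem exists_isIdempotentElem_mem_closure_pow {a : R} {C : ℝ} (h : ∀ k : ℕ, ‖a ^ k‖ ≤ C) :
    ∃ e ∈ closure (Set.range fun j : ℕ => a ^ (j + 1)), e * e = e := by
  -- Ellis–Numakura: a nonempty compact semigroup contains an idempotent.
  refine exists_idempotent_in_compact_subsemigroup (fun r => continuous_mul_const r) _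
    (Set.range_nonempty _).closure ?_ ?_
  · refine Metric.isCompact_of_isClosed_isBounded isClosed_closure ?_
    refine (isBounded_iff_forall_norm_le.2 ⟨C, ?_⟩ :
      Bornology.IsBounded (Set.range fun j : ℕ => a ^ (j + 1))).closure
    rintro _ ⟨j, rfl⟩
    exact h _
  · intro x hx y hy
    refine map_mem_closure₂ continuous_mul hx hy ?_
    rintro _ ⟨i, rfl⟩ _ ⟨j, rfl⟩
    exact ⟨i + 1 + j, by simp only [← pow_add]; congr 1⟩

end Idempotent

/-! ### Quadratic Lyapunov forms for power-bounded operators -/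

section Hilbert

variable {H : Type*} [NormedAddCommGroup H] [InnerProductSpace ℝ H] [FiniteDimensional ℝ H]

open scoped InnerProductSpace

/-- A power-bounded operator leaves invariant a self-adjoint quadratic form which is bounded below
at `x` by every lower bound for `‖T ^ k x‖ ^ 2` along the orbit of `x`. -/
theorem exists_invariant_form {T : H →L[ℝ] H} {C : ℝ} (h : ∀ k : ℕ, ‖T ^ k‖ ≤ C) :
    ∃ P : H →L[ℝ] H, IsSelfAdjoint P ∧ (∀ x, ⟪P (T x), T x⟫_ℝ = ⟪P x, x⟫_ℝ) ∧
      ∀ (x : H) (c : ℝ), (∀ k : ℕ, c ≤ ‖(T ^ k) x‖ ^ 2) → c ≤ ⟪P x, x⟫_ℝ := by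
  have : CompleteSpace H := FiniteDimensional.complete ℝ H
  have : ProperSpace (H →L[ℝ] H) := FiniteDimensional.proper ℝ _
  set S : ℕ → H →L[ℝ] H := fun N =>
    ((N : ℝ) + 1)⁻¹ • ∑ k ∈ Finset.range (N + 1), star (T ^ k) * T ^ k with hS
  have hSapp : ∀ N x, ⟪S N x, x⟫_ℝ =
      ((N : ℝ) + 1)⁻¹ * ∑ k ∈ Finset.range (N + 1), ‖(T ^ k) x‖ ^ 2 := by
    intro N x
    simp only [hS, smul_apply, sum_apply,
      real_inner_smul_left, sum_inner, ContinuousLinearMap.star_eq_adjoint,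
      mul_apply_eq_comp, ContinuousLinearMap.adjoint_inner_left,
      real_inner_self_eq_norm_sq]
  have hSbdd : ∀ N, S N ∈ Metric.closedBall (0 : H →L[ℝ] H) (C ^ 2) := by
    intro N
    rw [mem_closedBall_zero_iff, hS]
    have hN : (0 : ℝ) < (N : ℝ) + 1 := by positivity
    rw [norm_smul, Real.norm_of_nonneg (by positivity), inv_mul_le_iff₀ hN]
    refine (norm_sum_le_of_le (Finset.range (N + 1)) (f := fun k => star (T ^ k) * T ^ k)
      (n := fun _ => C ^ 2) fun k _ => ?_).trans (by simp)
    refine (CStarRing.norm_star_mul_self.trans (sq _).symm).trans_le ?_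
    exact pow_le_pow_left₀ (norm_nonneg _) (h k) 2
  obtain ⟨P, -, φ, hφ, hP⟩ := tendsto_subseq_of_bounded Metric.isBounded_closedBall hSbdd
  have hPapp : ∀ x, Tendsto (fun i => ⟪S (φ i) x, x⟫_ℝ) atTop (𝓝 ⟪P x, x⟫_ℝ) := fun x =>
    (((ContinuousLinearMap.apply ℝ H x).continuous.tendsto P).comp hP).inner tendsto_const_nhds
  refine ⟨P, ?_, fun x => ?_, fun x c hx => ?_⟩
  · refine (isClosed_eq ContinuousLinearMap.adjoint.continuous continuous_id :
      IsClosed {M : H →L[ℝ] H | star M = M}).mem_of_tendsto hP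
      (Eventually.of_forall fun i => ?_)
    refine IsSelfAdjoint.smul (IsSelfAdjoint.all _) (isSelfAdjoint_sum _ fun k _ => ?_)
    exact IsSelfAdjoint.star_mul_self _
  · refine tendsto_nhds_unique (hPapp (T x)) ?_
    -- Shifting the orbit changes the sum only by its two end terms, which are bounded, so the
    -- average is invariant in the limit.
    have hdiff : ∀ N, ⟪S N (T x), T x⟫_ℝ = ⟪S N x, x⟫_ℝ +
        ((N : ℝ) + 1)⁻¹ * (‖(T ^ (N + 1)) x‖ ^ 2 - ‖x‖ ^ 2) := by
      intro N
      rw [hSapp, hSapp, ← mul_add]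
      congr 1
      have h1 := Finset.sum_range_succ (fun k => ‖(T ^ k) x‖ ^ 2) (N + 1)
      have h2 := Finset.sum_range_succ' (fun k => ‖(T ^ k) x‖ ^ 2) (N + 1)
      have h3 : ∀ k, (T ^ (k + 1)) x = (T ^ k) (T x) := fun k => by rw [pow_succ]; rfl
      simp only [h3, pow_zero, one_apply_eq_self] at h1 h2 ⊢
      linarith
    have hzero : Tendsto (fun N : ℕ => ((N : ℝ) + 1)⁻¹ * (‖(T ^ (N + 1)) x‖ ^ 2 - ‖x‖ ^ 2))
        atTop (𝓝 0) := by
      have h0 : Tendsto (fun N : ℕ => ((N : ℝ) + 1)⁻¹) atTop (𝓝 0) := by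
        simpa [one_div] using tendsto_one_div_add_atTop_nhds_zero_nat (𝕜 := ℝ)
      refine h0.zero_mul_isBoundedUnder_le
        (isBoundedUnder_of ⟨(C * ‖x‖) ^ 2 + ‖x‖ ^ 2, fun N => ?_⟩)
      have hb : ‖(T ^ (N + 1)) x‖ ^ 2 ≤ (C * ‖x‖) ^ 2 :=
        pow_le_pow_left₀ (norm_nonneg _) (ContinuousLinearMap.le_of_opNorm_le _ (h _) x) 2
      simp only [Function.comp, Real.norm_eq_abs]
      rw [abs_le]
      constructor <;> nlinarith [sq_nonneg ‖(T ^ (N + 1)) x‖, sq_nonneg ‖x‖, sq_nonneg (C * ‖x‖)]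
    simp only [hdiff]
    simpa using (hPapp x).add (hzero.comp hφ.tendsto_atTop)
  · refine ge_of_tendsto (hPapp x) (Eventually.of_forall fun i => ?_)
    have hN : (0 : ℝ) < (φ i : ℝ) + 1 := by positivity
    rw [hSapp, le_inv_mul_iff₀ hN]
    simpa using Finset.card_nsmul_le_sum (Finset.range (φ i + 1))
      (fun k => ‖(T ^ k) x‖ ^ 2) c fun k _ => hx k

/-- Every power-bounded operator on a finite-dimensional inner product space is a contraction for
another inner product. -/
theorem exists_quadratic_lyapunov {T : H →L[ℝ] H} {C : ℝ} (h : ∀ k : ℕ, ‖T ^ k‖ ≤ C) :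
    ∃ P : H →L[ℝ] H, IsSelfAdjoint P ∧ (∀ x ≠ 0, 0 < ⟪P x, x⟫_ℝ) ∧
      ∀ x, ⟪P (T x), T x⟫_ℝ ≤ ⟪P x, x⟫_ℝ := by
  have : CompleteSpace H := FiniteDimensional.complete ℝ H
  have : ProperSpace (H →L[ℝ] H) := FiniteDimensional.proper ℝ _
  obtain ⟨E, hE, hEE⟩ := exists_isIdempotentElem_mem_closure_pow h
  have hmem : ∀ s : Set (H →L[ℝ] H), IsClosed s → (∀ j : ℕ, T ^ (j + 1) ∈ s) → E ∈ s :=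
    fun s hs hj => closure_minimal (Set.range_subset_iff.2 hj) hs hE
  have hcomm : E * T = T * E :=
    hmem {M | M * T = T * M} (isClosed_eq (by fun_prop) (by fun_prop))
      fun j => (Commute.pow_self T (j + 1)).eq
  -- `(T^(j+1))^k = T^(jk) T^k` has norm at most `C * ‖T^k x‖` at `x`; pass to the limit `E`. The
  -- exponent `j+1 ≥ 1` is what lets `T^k` split off.
  have hlower : ∀ x, E x = x → ∀ k : ℕ, ‖x‖ ≤ C * ‖(T ^ k) x‖ := by
    intro x hx k
    have hk : E ∈ {M : H →L[ℝ] H | ‖(M ^ k) x‖ ≤ C * ‖(T ^ k) x‖} := by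
      refine hmem _ (isClosed_le ?_ continuous_const) fun j => ?_
      · exact ((ContinuousLinearMap.apply ℝ H x).continuous.comp (continuous_pow k)).norm
      · have : ((T ^ (j + 1)) ^ k) x = (T ^ (j * k)) ((T ^ k) x) := by
          rw [← pow_mul, add_mul, one_mul, pow_add]; rfl
        rw [Set.mem_ofPred_eq, this]
        exact ContinuousLinearMap.le_of_opNorm_le _ (h _) _
    have hEk : ∀ k : ℕ, (E ^ k) x = x := by
      intro k
      induction k with
      | zero => simp
      | succ k ih => rw [pow_succ, mul_apply_eq_comp, hx, ih]
    simpa only [Set.mem_ofPred_eq, hEk] using hk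
  -- Otherwise the bound `1 ≤` would pass to the limit `E(1 - E) = 0`.
  obtain ⟨m, hm⟩ : ∃ m : ℕ, ‖T ^ (m + 1) * (1 - E)‖ < 1 := by
    by_contra! hcon
    have : E ∈ {M : H →L[ℝ] H | 1 ≤ ‖M * (1 - E)‖} :=
      hmem _ (isClosed_le continuous_const (by fun_prop)) hcon
    rw [Set.mem_ofPred_eq, mul_sub, mul_one, hEE, sub_self, norm_zero] at this
    linarith
  obtain ⟨Q, hQ, hQT, hQpos⟩ := exists_invariant_form h
  set F : H →L[ℝ] H := 1 - E with hF
  have hFF : F * F = F := by simp [hF, mul_sub, sub_mul, hEE]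
  have hFT : F * T = T * F := by simp [hF, mul_sub, sub_mul, hcomm]
  -- Applying `T` telescopes: `G` changes by `‖T^(m+1) F x‖² - ‖F x‖²`, which is at most 0 by the
  -- choice of `m`.
  set G : H →L[ℝ] H := ∑ k ∈ Finset.range (m + 1), star (T ^ k * F) * (T ^ k * F) with hG
  have hGapp : ∀ x, ⟪G x, x⟫_ℝ = ∑ k ∈ Finset.range (m + 1), ‖(T ^ k) (F x)‖ ^ 2 := by
    intro x
    simp only [hG, sum_apply, sum_inner]
    refine Finset.sum_congr rfl fun k _ => ?_
    rw [ContinuousLinearMap.star_eq_adjoint, mul_apply_eq_comp,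
      ContinuousLinearMap.adjoint_inner_left, real_inner_self_eq_norm_sq]
    rfl
  have hQnn : ∀ x, 0 ≤ ⟪Q x, x⟫_ℝ := fun x => hQpos x 0 fun k => by positivity
  have hGF : ∀ x, ‖F x‖ ^ 2 ≤ ⟪G x, x⟫_ℝ := by
    intro x
    rw [hGapp, Finset.sum_range_succ']
    simpa using Finset.sum_nonneg fun (k : ℕ) (_ : k ∈ Finset.range m) =>
      sq_nonneg ‖(T ^ (k + 1)) (F x)‖
  refine ⟨Q + G, hQ.add (isSelfAdjoint_sum _ fun k _ => IsSelfAdjoint.star_mul_self _),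
    fun x hx => ?_, fun x => ?_⟩
  · rw [add_apply, inner_add_left]
    by_cases hFx : F x = 0
    · have hEx : E x = x := by
        rw [hF, sub_apply, one_apply_eq_self, sub_eq_zero] at hFx
        exact hFx.symm
      have hxpos : 0 < ‖x‖ := norm_pos_iff.2 hx
      have hC : 0 < C := by
        have h0 := hlower x hEx 0
        rw [pow_zero, one_apply_eq_self] at h0
        by_contra! hC
        nlinarith
      refine add_pos_of_pos_of_nonneg (lt_of_lt_of_le (by positivity : 0 < (‖x‖ / C) ^ 2)
        (hQpos x _ fun k => ?_)) ((sq_nonneg _).trans (hGF x))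
      refine pow_le_pow_left₀ (by positivity) ?_ 2
      rw [div_le_iff₀' hC]
      exact hlower x hEx k
    · exact add_pos_of_nonneg_of_pos (hQnn x)
        (lt_of_lt_of_le (by have := norm_pos_iff.2 hFx; positivity) (hGF x))
  · simp only [add_apply, inner_add_left]
    rw [hQT]
    have hFTx : F (T x) = T (F x) := DFunLike.congr_fun hFT x
    have h1 := Finset.sum_range_succ (fun k => ‖(T ^ k) (F x)‖ ^ 2) (m + 1)
    have h2 := Finset.sum_range_succ' (fun k => ‖(T ^ k) (F x)‖ ^ 2) (m + 1)
    have h3 : ∀ k, (T ^ (k + 1)) (F x) = (T ^ k) (F (T x)) := fun k => by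
      rw [pow_succ, hFTx]; rfl
    have h4 : ‖(T ^ (m + 1)) (F x)‖ ≤ ‖F x‖ := by
      have h5 := ContinuousLinearMap.le_of_opNorm_le _ hm.le (F x)
      rwa [mul_apply_eq_comp, ← mul_apply_eq_comp F F, hFF, one_mul] at h5
    have h6 : ‖(T ^ (m + 1)) (F x)‖ ^ 2 ≤ ‖F x‖ ^ 2 := pow_le_pow_left₀ (norm_nonneg _) h4 2
    rw [hGapp, hGapp]
    rw [h2, pow_zero, one_apply_eq_self] at h1
    simp only [← h3]
    linarith

end Hilbert

/-! ### Matrix inequalities and the linear system -/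

section LinearSystem

variable {n : ℕ}

theorem marginallyStable_iff_exists_norm_pow_le (A : Matrix (Fin n) (Fin n) ℝ) :
    MarginallyStable A ↔ ∃ C : ℝ, ∀ k : ℕ, ‖Matrix.toEuclideanCLM (𝕜 := ℝ) A ^ k‖ ≤ C := by
  rw [marginallyStable_iff_uniform]
  simp only [← map_pow]
  constructor
  · rintro ⟨c, hc, h⟩
    refine ⟨c, fun k => ContinuousLinearMap.opNorm_le_bound _ hc fun v => ?_⟩
    simpa using h (fun k => Matrix.toEuclideanCLM (𝕜 := ℝ) (A ^ k) v)
      ((isSolution_iff A _).2 (by intro k; simp)) k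
  · rintro ⟨C, h⟩
    refine ⟨C, (norm_nonneg _).trans (h 0), fun x hx k => ?_⟩
    rw [(isSolution_iff A x).1 hx k]
    exact ContinuousLinearMap.le_of_opNorm_le _ (h k) _

theorem marginallyStable_transpose_iff (A : Matrix (Fin n) (Fin n) ℝ) :
    MarginallyStable Aᵀ ↔ MarginallyStable A := by
  have h : Aᵀ = star A := by
    rw [Matrix.star_eq_conjTranspose, Matrix.conjTranspose_eq_transpose_of_trivial]
  simp only [marginallyStable_iff_exists_norm_pow_le, h, map_star, ← star_pow]
  exact exists_congr fun C => forall_congr' fun k => by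
    rw [ContinuousLinearMap.star_eq_adjoint, LinearIsometryEquiv.norm_map]

theorem observerLMI_transpose_iff (A S X : Matrix (Fin n) (Fin n) ℝ) :
    ObserverLMI Aᵀ S Xᵀ ↔ ControllerLMI A S X := by
  simp only [ObserverLMI, ControllerLMI, Matrix.transpose_transpose, add_comm]

theorem dotProduct_fromBlocks_mulVec_elim (P B D : Matrix (Fin n) (Fin n) ℝ)
    (u v : Fin n → ℝ) :
    Sum.elim u v ⬝ᵥ (Matrix.fromBlocks P B Bᵀ D *ᵥ Sum.elim u v) =
      u ⬝ᵥ (P *ᵥ u) + 2 * (u ⬝ᵥ (B *ᵥ v)) + v ⬝ᵥ (D *ᵥ v) := by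
  have h : v ⬝ᵥ (Bᵀ *ᵥ u) = u ⬝ᵥ (B *ᵥ v) := by
    rw [Matrix.dotProduct_mulVec, Matrix.vecMul_transpose, dotProduct_comm]
  rw [Matrix.fromBlocks_mulVec, sumElim_dotProduct_sumElim, Sum.elim_comp_inl, Sum.elim_comp_inr,
    dotProduct_add, dotProduct_add, h]
  ring

theorem dotProduct_add_transpose_mulVec (X : Matrix (Fin n) (Fin n) ℝ) (v : Fin n → ℝ) :
    v ⬝ᵥ ((X + Xᵀ) *ᵥ v) = 2 * (v ⬝ᵥ (X *ᵥ v)) := by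
  rw [Matrix.add_mulVec, dotProduct_add, Matrix.dotProduct_mulVec v Xᵀ, Matrix.vecMul_transpose,
    dotProduct_comm (X *ᵥ v)]
  ring

theorem ObserverLMI.quadratic_nonneg {A P X : Matrix (Fin n) (Fin n) ℝ} (h : ObserverLMI A P X)
    (u v : Fin n → ℝ) :
    0 ≤ u ⬝ᵥ (P *ᵥ u) + 2 * (v ⬝ᵥ (X *ᵥ (A *ᵥ u))) +
      (2 * (v ⬝ᵥ (X *ᵥ v)) - v ⬝ᵥ (P *ᵥ v)) := by
  have h0 := h.dotProduct_mulVec_nonneg (Sum.elim u v)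
  rw [star_trivial, dotProduct_fromBlocks_mulVec_elim, Matrix.sub_mulVec, dotProduct_sub,
    dotProduct_add_transpose_mulVec, ← Matrix.transpose_mul, Matrix.dotProduct_mulVec u (X * A)ᵀ,
    Matrix.vecMul_transpose, dotProduct_comm _ v, ← Matrix.mulVec_mulVec] at h0
  exact h0

theorem ObserverLMI.isUnit {A P X : Matrix (Fin n) (Fin n) ℝ} (hP : P.PosDef)
    (h : ObserverLMI A P X) : IsUnit X := by
  rw [← Matrix.mulVec_injective_iff_isUnit]
  refine (injective_iff_map_eq_zero X.mulVecLin).2 ?_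
  intro v hv
  rw [Matrix.mulVecLin_apply] at hv
  by_contra hne
  -- If `Xv = 0`, the block form at `(0, v)` is `-vᵀPv`.
  have h1 := hP.dotProduct_mulVec_pos hne
  have h2 := h.quadratic_nonneg 0 v
  simp only [hv, Matrix.mulVec_zero, dotProduct_zero, star_trivial] at h1 h2
  linarith

theorem ObserverLMI.lyapunov {A P X : Matrix (Fin n) (Fin n) ℝ} (h : ObserverLMI A P X)
    (x : Fin n → ℝ) : (A *ᵥ x) ⬝ᵥ (P *ᵥ (A *ᵥ x)) ≤ x ⬝ᵥ (P *ᵥ x) := by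
  have h0 := h.quadratic_nonneg x (-(A *ᵥ x))
  simp only [Matrix.mulVec_neg, neg_dotProduct, dotProduct_neg] at h0
  linarith

open scoped MatrixOrder Matrix.Norms.L2Operator in
-- Writing `P = B*B` with `B` invertible, `‖B x_k‖` is nonincreasing, so `‖B⁻¹‖ ‖B‖` serves as the
-- constant.
theorem ObserverLMI.marginallyStable {A P X : Matrix (Fin n) (Fin n) ℝ} (hP : P.PosDef)
    (h : ObserverLMI A P X) : MarginallyStable A := by
  obtain ⟨B, rfl⟩ := CStarAlgebra.nonneg_iff_eq_star_mul_self.mp hP.posSemidef.nonneg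
  obtain ⟨B, rfl⟩ : IsUnit B := isUnit_of_mul_isUnit_right hP.isUnit
  intro x hx
  set b := Matrix.toEuclideanCLM (n := Fin n) (𝕜 := ℝ) (B : Matrix (Fin n) (Fin n) ℝ) with hb
  set b' := Matrix.toEuclideanCLM (n := Fin n) (𝕜 := ℝ) (↑B⁻¹ : Matrix (Fin n) (Fin n) ℝ) with hb'
  have hbb : ∀ v, b' (b v) = v := fun v => by
    rw [← mul_apply_eq_comp, hb, hb', ← map_mul, Units.inv_mul, map_one,
      one_apply_eq_self]
  have hnorm : ∀ v, ‖b v‖ ^ 2 =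
      v.ofLp ⬝ᵥ ((star (B : Matrix (Fin n) (Fin n) ℝ) * (B : Matrix (Fin n) (Fin n) ℝ)) *ᵥ v.ofLp) := fun v => by
    rw [← Matrix.inner_toEuclideanCLM, map_mul, map_star, ContinuousLinearMap.star_eq_adjoint,
      mul_apply_eq_comp, ContinuousLinearMap.adjoint_inner_right,
      real_inner_self_eq_norm_sq]
  have hanti : Antitone fun k => ‖b (x k)‖ := antitone_nat_of_succ_le fun k => by
    refine (sq_le_sq₀ (norm_nonneg _) (norm_nonneg _)).1 ?_
    rw [hnorm, hnorm, hx k]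
    exact h.lyapunov _
  refine ⟨‖b'‖ * ‖b‖, by positivity, fun k => ?_⟩
  calc ‖x k‖ = ‖b' (b (x k))‖ := by rw [hbb]
    _ ≤ ‖b'‖ * ‖b (x k)‖ := b'.le_opNorm _
    _ ≤ ‖b'‖ * (‖b‖ * ‖x 0‖) := by
      gcongr
      exact (hanti (Nat.zero_le k)).trans (b.le_opNorm _)
    _ = ‖b'‖ * ‖b‖ * ‖x 0‖ := (mul_assoc _ _ _).symm

/-- With `X = P` the block form at `(u, v)` is `(v+Au)ᵀP(v+Au) + uᵀPu - (Au)ᵀP(Au)`. -/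
theorem observerLMI_self {A P : Matrix (Fin n) (Fin n) ℝ} (hP : P.PosDef)
    (h : ∀ x : Fin n → ℝ, (A *ᵥ x) ⬝ᵥ (P *ᵥ (A *ᵥ x)) ≤ x ⬝ᵥ (P *ᵥ x)) : ObserverLMI A P P := by
  have hPt : Pᵀ = P := by
    rw [← Matrix.conjTranspose_eq_transpose_of_trivial]; exact hP.isHermitian
  refine Matrix.PosSemidef.of_dotProduct_mulVec_nonneg ?_ fun x => ?_
  · rw [Matrix.isHermitian_fromBlocks_iff]
    simp only [Matrix.IsHermitian, Matrix.conjTranspose_eq_transpose_of_trivial]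
    simp [hPt]
  · obtain ⟨u, v, rfl⟩ : ∃ u v : Fin n → ℝ, x = Sum.elim u v :=
      ⟨_, _, (Sum.elim_comp_inl_inr x).symm⟩
    have h0 := hP.posSemidef.dotProduct_mulVec_nonneg (v + A *ᵥ u)
    have hsymm : (A *ᵥ u) ⬝ᵥ (P *ᵥ v) = v ⬝ᵥ (P *ᵥ (A *ᵥ u)) := by
      rw [Matrix.dotProduct_mulVec, ← Matrix.mulVec_transpose, hPt, dotProduct_comm]
    have hcross : u ⬝ᵥ ((Aᵀ * Pᵀ) *ᵥ v) = (A *ᵥ u) ⬝ᵥ (P *ᵥ v) := by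
      rw [hPt, ← Matrix.mulVec_mulVec, Matrix.dotProduct_mulVec, Matrix.vecMul_transpose]
    rw [star_trivial] at h0 ⊢
    rw [dotProduct_fromBlocks_mulVec_elim, hcross, hPt, add_sub_cancel_right]
    simp only [Matrix.mulVec_add, dotProduct_add, add_dotProduct] at h0
    linarith [h u]

theorem MarginallyStable.exists_observerLMI {A : Matrix (Fin n) (Fin n) ℝ}
    (h : MarginallyStable A) :
    ∃ P X : Matrix (Fin n) (Fin n) ℝ, P.PosDef ∧ ObserverLMI A P X := by
  obtain ⟨C, hC⟩ := (marginallyStable_iff_exists_norm_pow_le A).1 h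
  obtain ⟨Q, hQ, hpos, hle⟩ := exists_quadratic_lyapunov hC
  obtain ⟨P, rfl⟩ := (Matrix.toEuclideanCLM (n := Fin n) (𝕜 := ℝ)).toEquiv.surjective Q
  change IsSelfAdjoint (Matrix.toEuclideanCLM (𝕜 := ℝ) P) at hQ
  have happ : ∀ x : EuclideanSpace ℝ (Fin n),
      inner ℝ (Matrix.toEuclideanCLM (𝕜 := ℝ) P x) x = x.ofLp ⬝ᵥ (P *ᵥ x.ofLp) := fun x => by
    rw [real_inner_comm, Matrix.inner_toEuclideanCLM]
  have hP : P.PosDef := by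
    refine Matrix.PosDef.of_dotProduct_mulVec_pos ?_ fun x hx => ?_
    · rw [IsSelfAdjoint, ← map_star] at hQ
      exact Matrix.toEuclideanCLM.injective hQ
    · exact (hpos (WithLp.toLp 2 x) (by simpa using hx)).trans_eq (happ _)
  refine ⟨P, P, hP, observerLMI_self hP fun x => ?_⟩
  exact (happ _).symm.trans_le ((hle (WithLp.toLp 2 x)).trans_eq (happ _))

theorem marginallyStable_iff_exists_observerLMI (A : Matrix (Fin n) (Fin n) ℝ) :
    MarginallyStable A ↔
      ∃ P X : Matrix (Fin n) (Fin n) ℝ, P.PosDef ∧ ObserverLMI A P X :=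
  ⟨fun h => h.exists_observerLMI, fun ⟨_, _, hP, h⟩ => h.marginallyStable hP⟩

end LinearSystem

theorem proposition1 {n : ℕ} (A : Matrix (Fin n) (Fin n) ℝ) :
    List.TFAE
      [MarginallyStable A,
        ∃ P X : Matrix (Fin n) (Fin n) ℝ, P.PosDef ∧ ObserverLMI A P X,
        ∃ S X : Matrix (Fin n) (Fin n) ℝ, S.PosDef ∧ ControllerLMI A S X] ∧
    (∀ P X : Matrix (Fin n) (Fin n) ℝ, P.PosDef → ObserverLMI A P X → IsUnit X) ∧
    (∀ S X : Matrix (Fin n) (Fin n) ℝ, S.PosDef → ControllerLMI A S X → IsUnit X) := by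
  refine ⟨?_, fun P X hP h => h.isUnit hP, fun S X hS h => ?_⟩
  · tfae_have 1 ↔ 2 := marginallyStable_iff_exists_observerLMI A
    tfae_have 1 ↔ 3 := by
      rw [← marginallyStable_transpose_iff, marginallyStable_iff_exists_observerLMI]
      refine exists_congr fun S => ⟨fun ⟨X, hS, h⟩ => ⟨Xᵀ, hS, ?_⟩,
        fun ⟨X, hS, h⟩ => ⟨Xᵀ, hS, (observerLMI_transpose_iff A S X).2 h⟩⟩
      rwa [← observerLMI_transpose_iff, Matrix.transpose_transpose]
    tfae_finish
  · exact (Matrix.isUnit_transpose X).1 (((observerLMI_transpose_iff A S X).2 h).isUnit hS)
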